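/- Let $R$ be a commutative ring, $I\subseteq R$ an ideal, $X=\mathrm{Spec}(R)$, and $Z=\mathrm{Spec}(R/I)$ the closed subscheme of $X$ defined by $I$. Let $\widetilde R=\bigoplus_{n\ge 0} I^n t^n\subseteq R[t]$ be the Rees algebra of $I$, graded by the degree in $t$ (with $I^0=R$), and let $\pi:\widetilde X=\mathrm{Proj}(\widetilde R)\to X$ be the morphism given by the natural ring homomorphism $R\to\widetilde R$. Call a closed subscheme $D$ of a scheme $Y$ a Cartier divisor in $Y$ if every point of $D$ has an affine open neighbourhood $U$ in $Y$ such that the ideal of $D\cap U$ in $\Gamma(U,\mathcal O_Y)$ is generated by one non-zero-divisor (the empty subscheme is a Cartier divisor). Then $\pi$ satisfies the universal property of the blowup of $X$ along $Z$: 1. the scheme-theoretic inverse image $\pi^{-1}(Z)=\widetilde X\times_X Z$ is a Cartier divisor in $\widetilde X$; and 2. for every scheme $Y$ and every morphism $\tau:Y\to X$ such that the scheme-theoretic inverse image $\tau^{-1}(Z)=Y\times_X Z$ is a Cartier divisor in $Y$, there exists a unique morphism $\sigma:Y\to\widetilde X$ with $\tau=\pi\circ\sigma$. -/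

import Mathlib

open AlgebraicGeometry CategoryTheory CategoryTheory.Limits
open scoped Polynomial

universe u

namespace ReesBlowup

section Grading

variable {R : Type u} [CommRing R]

/-- The degree `n` part `Iⁿ tⁿ` of the Rees algebra `⨁ₙ Iⁿ tⁿ ⊆ R[t]` of `I`: the elements of the
Rees algebra whose coefficients outside degree `n` vanish. -/
def grading (I : Ideal R) (n : ℕ) : Submodule R (reesAlgebra I) where
  carrier := {f | ∀ i, i ≠ n → (f : R[X]).coeff i = 0}
  add_mem' hf hg i hi := by simp [hf i hi, hg i hi]
  zero_mem' i _ := by simp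
  smul_mem' r f hf i hi := by simp [hf i hi]

theorem mem_grading_iff {I : Ideal R} {n : ℕ} {f : reesAlgebra I} :
    f ∈ grading I n ↔ (f : R[X]) = Polynomial.monomial n ((f : R[X]).coeff n) := by
  constructor
  · intro hf
    ext i
    rw [Polynomial.coeff_monomial]
    split_ifs with h
    · rw [h]
    · exact hf i (Ne.symm h)
  · intro hf i hi
    rw [hf, Polynomial.coeff_monomial, if_neg (Ne.symm hi)]

instance grading_gradedMonoid (I : Ideal R) : SetLike.GradedMonoid (grading I) where
  one_mem i hi := by simp [Polynomial.coeff_one, hi]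
  mul_mem m n f g hf hg i hi := by
    rw [mem_grading_iff] at hf hg
    rw [MulMemClass.coe_mul, hf, hg, Polynomial.monomial_mul_monomial, Polynomial.coeff_monomial,
      if_neg (Ne.symm hi)]

/-- The homogeneous component `cₙ tⁿ` of an element `∑ cᵢ tⁱ` of the Rees algebra. -/
noncomputable def component (I : Ideal R) (f : reesAlgebra I) (n : ℕ) : grading I n :=
  ⟨⟨Polynomial.monomial n ((f : R[X]).coeff n), reesAlgebra.monomial_mem.mpr (f.2 n)⟩,
    fun i hi => by simp [Polynomial.coeff_monomial, Ne.symm hi]⟩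

theorem coeff_coe (I : Ideal R) (x : DirectSum ℕ fun n => grading I n) (j : ℕ) :
    ((DirectSum.coeAddMonoidHom (grading I) x : reesAlgebra I) : R[X]).coeff j =
      ((x j : reesAlgebra I) : R[X]).coeff j := by
  classical
  induction x using DirectSum.induction_on with
  | zero => simp
  | of i y =>
    rw [DirectSum.coeAddMonoidHom_of]
    by_cases h : i = j
    · subst h
      rw [DirectSum.of_eq_same]
    · rw [DirectSum.of_eq_of_ne _ _ _ (Ne.symm h), y.2 j (Ne.symm h)]
      simp
  | add x y hx hy => simp [hx, hy]

noncomputable instance grading_decomposition (I : Ideal R) :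
    DirectSum.Decomposition (grading I) where
  decompose' f := DirectSum.mk (fun n => grading I n) (f : R[X]).support fun i => component I f i
  left_inv f := by
    apply Subtype.ext
    ext j
    rw [coeff_coe]
    by_cases h : j ∈ (f : R[X]).support
    · rw [DirectSum.mk_apply_of_mem h]
      simp [component]
    · rw [DirectSum.mk_apply_of_notMem h]
      simpa using (Polynomial.notMem_support_iff.mp h).symm
  right_inv x := by
    refine DFinsupp.ext fun j => Subtype.ext (Subtype.ext ?_)
    rw [mem_grading_iff.mp (x j).2, ← coeff_coe]
    set f := DirectSum.coeAddMonoidHom (grading I) x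
    by_cases h : j ∈ (f : R[X]).support
    · rw [DirectSum.mk_apply_of_mem h]
      simp [component]
    · rw [DirectSum.mk_apply_of_notMem h, Polynomial.notMem_support_iff.mp h]
      simp

noncomputable instance grading_gradedAlgebra (I : Ideal R) : GradedAlgebra (grading I) where

end Grading

/-- The scheme `Proj` of the Rees algebra of `I`. -/
noncomputable def blowup {R : Type u} [CommRing R] (I : Ideal R) : Scheme.{u} :=
  Proj (grading I)

/-- The morphism `Proj (⨁ₙ Iⁿ) ⟶ Spec R` given by the natural ring homomorphism from `R` into the
(degree zero part of the) Rees algebra. -/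
noncomputable def blowupMap {R : Type u} [CommRing R] (I : Ideal R) :
    blowup I ⟶ Spec (CommRingCat.of R) :=
  Proj.toSpecZero (grading I) ≫
    Spec.map (CommRingCat.ofHom (algebraMap R (grading I 0)))

/-- The closed subscheme `Spec (R ⧸ I) ⟶ Spec R` defined by `I`. -/
noncomputable def center {R : Type u} [CommRing R] (I : Ideal R) :
    Spec (CommRingCat.of (R ⧸ I)) ⟶ Spec (CommRingCat.of R) :=
  Spec.map (CommRingCat.ofHom (Ideal.Quotient.mk I))

instance center_isClosedImmersion {R : Type u} [CommRing R] (I : Ideal R) :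
    IsClosedImmersion (center I) :=
  IsClosedImmersion.spec_of_surjective _ Ideal.Quotient.mk_surjective

/-- A closed subscheme `i : Z ⟶ X` is an (effective) Cartier divisor in `X` if every point of `Z`
has an affine open neighbourhood `U` in `X` such that the ideal of `Z` in `Γ(X, U)` is generated by
a single nonzerodivisor. The empty subscheme is a Cartier divisor. -/
def IsCartierDivisor {Z X : Scheme.{u}} (i : Z ⟶ X) [IsClosedImmersion i] : Prop :=
  ∀ z : Z, ∃ U : X.Opens, IsAffineOpen U ∧ i z ∈ U ∧
    ∃ h ∈ nonZeroDivisors Γ(X, U), RingHom.ker (i.app U).hom = Ideal.span {h}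

/-- The universal property of blowups: `π : X' ⟶ X` is a blowup of `X` along the closed subscheme
`i : Z ⟶ X` if the scheme-theoretic inverse image `X' ×[X] Z` is a Cartier divisor in `X'`, and every
`τ : Y ⟶ X` such that `Y ×[X] Z` is a Cartier divisor in `Y` factors uniquely through `π`. -/
structure IsBlowup {Z X X' : Scheme.{u}} (i : Z ⟶ X) [IsClosedImmersion i] (π : X' ⟶ X) :
    Prop where
  isCartierDivisor : IsCartierDivisor (pullback.fst π i)
  existsUnique : ∀ {Y : Scheme.{u}} (τ : Y ⟶ X), IsCartierDivisor (pullback.fst τ i) →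
    ∃! σ : Y ⟶ X', σ ≫ π = τ

end ReesBlowup

/-! Both halves reduce to one local condition: for `φ : R →+* B`, some `a ∈ I` has `φ a` a
nonzerodivisor dividing all of `φ(I)`. On an affine open, the inverse image of the centre is cut out
by the extension of `I`, so a Cartier inverse image has a nonzerodivisor as local equation; after
shrinking, it can be taken to be some `φ a` (`exists_generatesExtension_away`).

The blowup is covered by the charts on which `a t` is invertible, for `a ∈ I`. The ring of such a
chart consists of the fractions `r tⁿ / (a t)ⁿ` with `r ∈ Iⁿ`, that is, "`r / aⁿ`", and `a`
satisfies the condition there; this gives the first half. Given the condition on `B`, the quotient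
`φ r / φ a ^ n` exists and is unique in `B`, so there is exactly one map from the chart ring under
`R` (`exists_awayHom`, `awayHom_ext`). Every lift to the blowup must land in this chart
(`range_subset_range_chart`), so local lifts are unique and therefore glue. -/

namespace ReesBlowup

/-- The image of `a ∈ I` under `φ` is a nonzerodivisor generating the extension of `I`. -/
structure GeneratesExtension {R B : Type*} [CommRing R] [CommRing B] (I : Ideal R) (φ : R →+* B)
    (a : R) : Prop where
  mem : a ∈ I
  mem_nonZeroDivisors : φ a ∈ nonZeroDivisors B
  dvd : ∀ b ∈ I, φ a ∣ φ b

namespace GeneratesExtension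

variable {R B C : Type u} [CommRing R] [CommRing B] [CommRing C] {I : Ideal R} {φ : R →+* B} {a : R}

/-- Flat base change keeps multiplication by `φ a` injective. This makes the condition pass to every
affine open. -/
theorem comp_of_flat (h : GeneratesExtension I φ a) {ψ : B →+* C} (hψ : ψ.Flat) :
    GeneratesExtension I (ψ.comp φ) a where
  mem := h.mem
  mem_nonZeroDivisors := by
    algebraize [ψ]
    have := Module.Flat.isSMulRegular_of_nonZeroDivisors (M := C) h.mem_nonZeroDivisors
    rw [mem_nonZeroDivisors_iff_right]
    intro x hx
    apply this
    simpa [Algebra.smul_def, mul_comm, RingHom.algebraMap_toAlgebra] using hx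
  dvd b hb := by simpa using map_dvd ψ (h.dvd b hb)

theorem map_eq_span (h : GeneratesExtension I φ a) : I.map φ = Ideal.span {φ a} := by
  apply le_antisymm
  · rw [Ideal.map_le_iff_le_comap]
    exact fun b hb => Ideal.mem_span_singleton.mpr (h.dvd b hb)
  · rw [Ideal.span_singleton_le_iff_mem]
    exact Ideal.mem_map_of_mem φ h.mem

end GeneratesExtension

/-- If the extension of `I` is generated by a nonzerodivisor, then locally this generator may be
chosen among the images of the elements of `I`. -/
theorem exists_generatesExtension_away {R B : Type u} [CommRing R] [CommRing B] {I : Ideal R}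
    {φ : R →+* B} {h : B} (hh : h ∈ nonZeroDivisors B) (hI : I.map φ = Ideal.span {h})
    (p : PrimeSpectrum B) :
    ∃ f : B, f ∉ p.asIdeal ∧ ∃ a : R,
      GeneratesExtension I ((algebraMap B (Localization.Away f)).comp φ) a := by
  have hdvd : ∀ b ∈ I, h ∣ φ b := fun b hb =>
    Ideal.mem_span_singleton.mp (hI ▸ Ideal.mem_map_of_mem φ hb)
  by_contra! H
  -- Write `φ b = h * d`. If `d ∉ p`, then inverting `d` makes `φ b` an associate of `h`, so `b` is
  -- a generator. Otherwise every such `d` lies in `p`, so `h ∈ h p`, and cancelling `h` puts `1` in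
  -- `p`.
  have key : ∀ b ∈ I, φ b ∈ Ideal.span {h} * p.asIdeal := by
    intro b hb
    obtain ⟨d, hd⟩ := hdvd b hb
    rw [hd]
    refine Ideal.mul_mem_mul (Ideal.mem_span_singleton_self h) ?_
    by_contra hdp
    refine H d hdp b ⟨hb, ?_, ?_⟩
    · have hu : IsUnit (algebraMap B (Localization.Away d) d) :=
        IsLocalization.Away.algebraMap_isUnit d
      rw [RingHom.comp_apply, hd, map_mul]
      exact mul_mem (IsLocalization.map_nonZeroDivisors_le (Submonoid.powers d)
        (Localization.Away d) ⟨h, hh, rfl⟩) hu.mem_nonZeroDivisors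
    · intro c hc
      have hu : IsUnit (algebraMap B (Localization.Away d) d) :=
        IsLocalization.Away.algebraMap_isUnit d
      rw [RingHom.comp_apply, RingHom.comp_apply, hd, map_mul, hu.mul_right_dvd]
      exact map_dvd _ (hdvd c hc)
  have hmem : h ∈ Ideal.span {h} * p.asIdeal := by
    have : I.map φ ≤ Ideal.span {h} * p.asIdeal := Ideal.map_le_iff_le_comap.mpr key
    exact this (hI ▸ Ideal.mem_span_singleton_self h)
  obtain ⟨z, hz, hzh⟩ := Ideal.mem_span_singleton_mul.mp hmem
  have : (z - 1) * h = 0 := by linear_combination hzh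
  have hz1 := (mem_nonZeroDivisors_iff_right.mp hh) _ this
  exact p.2.ne_top ((Ideal.eq_top_iff_one _).mpr (by rwa [← sub_eq_zero.mp hz1]))

theorem le_preimage_top {X Y : Scheme.{u}} (f : X ⟶ Y) (U : X.Opens) : U ≤ f ⁻¹ᵁ ⊤ := le_top

/-! ### The ideal of the inverse image of the centre -/

section InverseImage

variable {R : Type u} [CommRing R] {Y : Scheme.{u}} (τ : Y ⟶ Spec (CommRingCat.of R))

/-- The ring homomorphism into the sections over `U` induced by a morphism to `Spec R`. -/
noncomputable def toSections (U : Y.Opens) : CommRingCat.of R ⟶ Γ(Y, U) :=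
  (Scheme.ΓSpecIso (CommRingCat.of R)).inv ≫ τ.appLE ⊤ U (le_preimage_top τ U)

theorem fromSpec_comp {U : Y.Opens} (hU : IsAffineOpen U) :
    hU.fromSpec ≫ τ = Spec.map (toSections τ U) := by
  rw [← IsAffineOpen.SpecMap_appLE_fromSpec τ (isAffineOpen_top _) hU (le_preimage_top τ U),
    IsAffineOpen.fromSpec_top, Scheme.isoSpec_Spec_inv, toSections, Spec.map_comp]

theorem toSections_eq {U : Y.Opens} (hU : IsAffineOpen U) {φ : CommRingCat.of R ⟶ Γ(Y, U)}
    (h : hU.fromSpec ≫ τ = Spec.map φ) : toSections τ U = φ :=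
  Spec.map_injective (by rw [← fromSpec_comp τ hU, h])

/-- Let `J` be the extension of `I` to `Γ(Y, U)`. `Spec (Γ(Y, U) ⧸ J)` maps to `Y` and to the centre
compatibly, hence factors through the pullback; a function vanishing on the pullback therefore lies
in `J`. Conversely, `I` dies on the pullback because it dies in `R ⧸ I`. -/
theorem ker_pullback_fst_app (I : Ideal R) {U : Y.Opens} (hU : IsAffineOpen U) :
    RingHom.ker ((pullback.fst τ (center I)).app U).hom = I.map (toSections τ U).hom := by
  set fst := pullback.fst τ (center I)
  apply le_antisymm
  · intro x hx
    rw [RingHom.mem_ker] at hx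
    let J : Ideal Γ(Y, U) := I.map (toSections τ U).hom
    let q : Γ(Y, U) ⟶ CommRingCat.of (Γ(Y, U) ⧸ J) := CommRingCat.ofHom (Ideal.Quotient.mk J)
    let g : Spec (CommRingCat.of (Γ(Y, U) ⧸ J)) ⟶ Y := Spec.map q ≫ hU.fromSpec
    let b : CommRingCat.of (R ⧸ I) ⟶ CommRingCat.of (Γ(Y, U) ⧸ J) :=
      CommRingCat.ofHom (Ideal.quotientMap J (toSections τ U).hom Ideal.le_comap_map)
    have hg : g ≫ τ = Spec.map b ≫ center I := by
      rw [Category.assoc, fromSpec_comp, center, ← Spec.map_comp, ← Spec.map_comp]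
      rfl
    let l := pullback.lift g (Spec.map b) hg
    have hl : l ≫ fst = g := pullback.lift_fst _ _ hg
    have hgU : ⊤ ≤ g ⁻¹ᵁ U := by simp [g]
    have h1 : g.appLE U ⊤ hgU = q ≫ (Scheme.ΓSpecIso _).inv := by
      have h6 : hU.fromSpec.appLE U ⊤ (by simp) = (Scheme.ΓSpecIso _).inv := by
        rw [Scheme.Hom.appLE, IsAffineOpen.fromSpec_app_self, Category.assoc, ← Functor.map_comp]
        exact (congrArg _ (CategoryTheory.Functor.map_id _ _)).trans (Category.comp_id _)
      rw [Scheme.ΓSpecIso_inv_naturality, ← h6, Scheme.Hom.appTop, Scheme.Hom.app_eq_appLE]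
      exact (Scheme.Hom.appLE_comp_appLE _ _ _ _ _ _ _).symm
    have h2 : g.app U x = 0 := by
      rw [Scheme.Hom.congr_app hl.symm U]
      simp [hx]
    have h3 : g.appLE U ⊤ hgU x = 0 := by
      simp [Scheme.Hom.appLE, h2]
    rw [h1] at h3
    have h4 : q x = 0 := by
      have h5 := congr((Scheme.ΓSpecIso _).hom $h3)
      rwa [map_zero, CommRingCat.comp_apply, Iso.inv_hom_id_apply] at h5
    exact Ideal.Quotient.eq_zero_iff_mem.mp h4
  · rw [Ideal.map_le_iff_le_comap]
    intro r hr
    have h1 : toSections τ U ≫ fst.app U = CommRingCat.ofHom (Ideal.Quotient.mk I) ≫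
        toSections (R := R ⧸ I) (pullback.snd τ (center I)) (fst ⁻¹ᵁ U) := by
      have h := Scheme.ΓSpecIso_inv_naturality (CommRingCat.ofHom (Ideal.Quotient.mk I))
      rw [toSections, toSections, ← Category.assoc, h, Category.assoc, Category.assoc,
        Scheme.Hom.app_eq_appLE, Scheme.Hom.appLE_comp_appLE]
      congr 1
      have := Scheme.Hom.comp_appLE (pullback.snd τ (center I)) (center I) ⊤ (fst ⁻¹ᵁ U)
        (le_preimage_top _ _)
      refine Eq.trans ?_ this
      congr 1
      exact pullback.condition
    have h2 := congr($h1 r)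
    rw [Ideal.mem_comap, RingHom.mem_ker]
    have h3 : Ideal.Quotient.mk I r = 0 := Ideal.Quotient.eq_zero_iff_mem.mpr hr
    simpa [h3] using h2

end InverseImage

/-! ### Chart rings of the Rees algebra -/

open HomogeneousLocalization

section Away

variable {R : Type u} [CommRing R] {I : Ideal R}

/-- The element `r tⁿ` of the Rees algebra for `r ∈ Iⁿ`. -/
noncomputable def reesMonomial {n : ℕ} {r : R} (hr : r ∈ I ^ n) : reesAlgebra I :=
  ⟨Polynomial.monomial n r, reesAlgebra.monomial_mem.mpr hr⟩

theorem reesMonomial_mem_grading {n : ℕ} {r : R} (hr : r ∈ I ^ n) :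
    reesMonomial hr ∈ grading I n := fun i hi => by
  simp [reesMonomial, Polynomial.coeff_monomial, Ne.symm hi]

theorem exists_eq_reesMonomial {n : ℕ} {x : reesAlgebra I} (hx : x ∈ grading I n) :
    ∃ (r : R) (hr : r ∈ I ^ n), x = reesMonomial hr :=
  ⟨(x : R[X]).coeff n, x.2 n, Subtype.ext (mem_grading_iff.mp hx)⟩

/-- The element `a t` of the Rees algebra for `a ∈ I`. -/
noncomputable def degreeOne {a : R} (ha : a ∈ I) : reesAlgebra I :=
  reesMonomial (n := 1) (by rwa [pow_one])

theorem degreeOne_mem_grading {a : R} (ha : a ∈ I) : degreeOne ha ∈ grading I 1 :=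
  reesMonomial_mem_grading _

theorem coe_degreeOne_pow {a : R} (ha : a ∈ I) (n : ℕ) :
    ((degreeOne ha ^ n : reesAlgebra I) : R[X]) = Polynomial.monomial n (a ^ n) := by
  simp [degreeOne, reesMonomial, Polynomial.monomial_pow]

/-- Holds because `Iⁿ⁺¹ = I * Iⁿ`; it is what makes the charts of the elements `a t` cover the
blowup. -/
theorem irrelevant_le_span_degreeOne (I : Ideal R) :
    (HomogeneousIdeal.irrelevant (grading I)).toIdeal ≤
      Ideal.span (Set.range fun a : I => degreeOne a.2) := by
  classical
  have key : ∀ (n : ℕ) (r : R) (hr : r ∈ I ^ (n + 1)),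
      reesMonomial hr ∈ Ideal.span (Set.range fun a : I => degreeOne a.2) := by
    intro n r hr
    have hr' := hr
    rw [pow_succ'] at hr'
    induction hr' using Submodule.mul_induction_on' with
    | mem_mul_mem a ha b hb =>
      have : reesMonomial hr = reesMonomial hb * degreeOne ha := by
        apply Subtype.ext
        simp [reesMonomial, degreeOne, Polynomial.monomial_mul_monomial, mul_comm]
      rw [this]
      exact Ideal.mul_mem_left _ _ (Ideal.subset_span ⟨⟨a, ha⟩, rfl⟩)
    | add x hx y hy hx' hy' =>
      rw [← pow_succ'] at hx hy
      have : reesMonomial hr = reesMonomial hx + reesMonomial hy := by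
        apply Subtype.ext
        simp [reesMonomial]
      rw [this]
      exact add_mem (hx' _) (hy' _)
  intro z hz
  rw [← DirectSum.sum_support_decompose (grading I) z]
  refine Ideal.sum_mem _ fun c _ => ?_
  rcases c with _ | c
  · have : ((DirectSum.decompose (grading I) z 0 : grading I 0) : reesAlgebra I) = 0 := hz
    rw [this]
    exact zero_mem _
  · obtain ⟨r, hr, h⟩ := exists_eq_reesMonomial (DirectSum.decompose (grading I) z (c + 1)).2
    rw [h]
    exact key c r hr

/-- The natural map from `R` to the degree zero part of a localization of the Rees algebra. -/
noncomputable def toAway (I : Ideal R) (f : reesAlgebra I) : R →+* Away (grading I) f :=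
  (fromZeroRingHom (grading I) (Submonoid.powers f)).comp (algebraMap R (grading I 0))

theorem val_toAway (f : reesAlgebra I) (r : R) :
    (toAway I f r).val = algebraMap (reesAlgebra I) (Localization.Away f)
      (algebraMap R (reesAlgebra I) r) := by
  rw [← Localization.mk_one_eq_algebraMap]
  rfl

/-- The fraction `r tⁿ / (a t)ⁿ`. -/
noncomputable def fraction {a : R} (ha : a ∈ I) {n : ℕ} {r : R} (hr : r ∈ I ^ n) :
    Away (grading I) (degreeOne ha) :=
  Away.mk (grading I) (degreeOne_mem_grading ha) n (reesMonomial hr)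
    (by simpa using reesMonomial_mem_grading hr)

theorem fraction_surjective {a : R} (ha : a ∈ I) (x : Away (grading I) (degreeOne ha)) :
    ∃ (n : ℕ) (r : R) (hr : r ∈ I ^ n), x = fraction ha hr := by
  obtain ⟨n, y, hy, rfl⟩ := Away.mk_surjective (grading I) (degreeOne_mem_grading ha) x
  have hy' : y ∈ grading I n := by simpa using hy
  obtain ⟨r, hr, rfl⟩ := exists_eq_reesMonomial hy'
  exact ⟨n, r, hr, rfl⟩

theorem val_fraction {a : R} (ha : a ∈ I) {n : ℕ} {r : R} (hr : r ∈ I ^ n) :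
    (fraction ha hr).val = IsLocalization.mk' (Localization.Away (degreeOne ha))
      (reesMonomial hr) (⟨degreeOne ha ^ n, n, rfl⟩ : Submonoid.powers (degreeOne ha)) := by
  rw [← Localization.mk_eq_mk']
  rfl

theorem fraction_mul_toAway_pow {a : R} (ha : a ∈ I) {n : ℕ} {r : R} (hr : r ∈ I ^ n) :
    fraction ha hr * toAway I _ (a ^ n) = toAway I _ r := by
  apply val_injective
  rw [val_mul, val_fraction, val_toAway, val_toAway, mul_comm, IsLocalization.mul_mk'_eq_mk'_of_mul,
    IsLocalization.mk'_eq_iff_eq_mul, ← map_mul]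
  congr 1
  apply Subtype.ext
  rw [MulMemClass.coe_mul, MulMemClass.coe_mul, coe_degreeOne_pow]
  change Polynomial.C (a ^ n) * Polynomial.monomial n r = Polynomial.C r * _
  rw [Polynomial.C_mul_monomial, Polynomial.C_mul_monomial, mul_comm]

theorem toAway_mem_nonZeroDivisors {a : R} (ha : a ∈ I) :
    toAway I (degreeOne ha) a ∈ nonZeroDivisors (Away (grading I) (degreeOne ha)) := by
  have hinj : Function.Injective (algebraMap (Away (grading I) (degreeOne ha))
      (Localization.Away (degreeOne ha))) := fun x y h => val_injective _ <| by
    rwa [HomogeneousLocalization.algebraMap_apply, HomogeneousLocalization.algebraMap_apply] at h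
  refine mem_nonZeroDivisors_of_injective hinj ?_
  rw [HomogeneousLocalization.algebraMap_apply, val_toAway, mem_nonZeroDivisors_iff_right]
  intro x hx
  obtain ⟨y, s, rfl⟩ := IsLocalization.exists_mk'_eq (Submonoid.powers (degreeOne ha)) x
  rw [mul_comm, IsLocalization.mul_mk'_eq_mk'_of_mul, IsLocalization.mk'_eq_zero_iff] at hx
  rw [IsLocalization.mk'_eq_zero_iff]
  obtain ⟨⟨_, m, rfl⟩, h⟩ := hx
  -- If `(a t)ᵐ` kills `a y`, then multiplying by `t` inside `R[t]` turns the factor `a` into `a t`,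
  -- so `(a t)ᵐ⁺¹` kills `y`.
  refine ⟨⟨_, m + 1, rfl⟩, Subtype.ext ?_⟩
  have h' := congr(Polynomial.X * ($h : R[X]))
  simp only [MulMemClass.coe_mul, coe_degreeOne_pow, ZeroMemClass.coe_zero, mul_zero] at h' ⊢
  rw [← h', pow_succ, ← Polynomial.monomial_mul_monomial, ← Polynomial.C_mul_X_eq_monomial]
  change _ = Polynomial.X * (_ * (Polynomial.C a * _))
  ring

theorem toAway_generatesExtension {a : R} (ha : a ∈ I) :
    GeneratesExtension I (toAway I (degreeOne ha)) a where
  mem := ha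
  mem_nonZeroDivisors := toAway_mem_nonZeroDivisors ha
  dvd b hb := by
    have hb' : b ∈ I ^ 1 := by rwa [pow_one]
    exact ⟨fraction ha hb', by rw [← fraction_mul_toAway_pow ha hb', _root_.pow_one]; exact mul_comm (fraction ha hb') _⟩

/-- A fraction `x = r tⁿ / (a t)ⁿ` satisfies `x * aⁿ = r`, and the image of `aⁿ` can be cancelled in
`B`. -/
theorem awayHom_ext {B : Type u} [CommRing B] {a : R} (ha : a ∈ I)
    {χ₁ χ₂ : Away (grading I) (degreeOne ha) →+* B}
    (h : χ₁.comp (toAway I _) = χ₂.comp (toAway I _))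
    (hn : χ₁ (toAway I _ a) ∈ nonZeroDivisors B) : χ₁ = χ₂ := by
  ext x
  obtain ⟨n, r, hr, rfl⟩ := fraction_surjective ha x
  have h' : ∀ s, χ₁ (toAway I _ s) = χ₂ (toAway I _ s) := fun s => congr($h s)
  rw [← sub_eq_zero]
  apply mem_nonZeroDivisors_iff_right.mp (pow_mem hn n)
  have h1 := congr(χ₁ $(fraction_mul_toAway_pow ha hr))
  have h2 := congr(χ₂ $(fraction_mul_toAway_pow ha hr))
  rw [map_mul] at h1 h2
  rw [sub_mul, ← map_pow, ← map_pow, h1, h', h', h2, sub_self]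

/-- Evaluate `t` at `1 / φ a` in the localization of `B` at `φ a`. Since `φ a ^ n` divides `φ r` for
`r ∈ Iⁿ`, the Rees algebra lands in `B`, and `a t` goes to `1`, so the map extends to the
localization. -/
theorem exists_awayHom {B : Type u} [CommRing B] {φ : R →+* B} {a : R}
    (h : GeneratesExtension I φ a) :
    ∃ χ : Away (grading I) (degreeOne h.mem) →+* B, χ.comp (toAway I _) = φ := by
  let S := Localization.Away (φ a)
  let u : S := IsLocalization.Away.invSelf (φ a)
  have hu : algebraMap B S (φ a) * u = 1 := IsLocalization.Away.mul_invSelf (φ a)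
  have hinj : Function.Injective (algebraMap B S) :=
    IsLocalization.injective _ (Submonoid.powers_le.mpr h.mem_nonZeroDivisors)
  let e : R[X] →+* S := Polynomial.eval₂RingHom ((algebraMap B S).comp φ) u
  have hpow : ∀ (n : ℕ) (r : R), r ∈ I ^ n → φ a ^ n ∣ φ r := by
    intro n r hr
    have := Ideal.mem_map_of_mem φ hr
    rw [Ideal.map_pow, h.map_eq_span, Ideal.span_singleton_pow] at this
    exact Ideal.mem_span_singleton.mp this
  have he : ∀ x : reesAlgebra I, e x ∈ (algebraMap B S).range := by
    intro x
    rw [(x : R[X]).as_sum_support, map_sum]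
    refine sum_mem fun n _ => ?_
    obtain ⟨c, hc⟩ := hpow n _ (x.2 n)
    refine ⟨c, ?_⟩
    simp only [e, Polynomial.coe_eval₂RingHom, Polynomial.eval₂_monomial, RingHom.comp_apply, hc,
      map_mul, map_pow]
    rw [mul_right_comm, ← mul_pow, hu, one_pow, one_mul]
  let i := RingEquiv.ofBijective (algebraMap B S).rangeRestrict
    ⟨fun x y h => hinj (congr_arg Subtype.val h), (algebraMap B S).rangeRestrict_surjective⟩
  let ψ : reesAlgebra I →+* B := i.symm.toRingHom.comp
    ((e.comp (reesAlgebra I).val.toRingHom).codRestrict _ he)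
  have hψ : ∀ x, algebraMap B S (ψ x) = e x := fun x => congr_arg Subtype.val (i.apply_symm_apply _)
  have hψa : ψ (degreeOne h.mem) = 1 := by
    apply hinj
    rw [hψ]
    simp [e, degreeOne, reesMonomial, hu]
  refine ⟨(IsLocalization.Away.lift (S := Localization.Away (degreeOne h.mem)) (g := ψ)
    (degreeOne h.mem) (by simp [hψa])).comp (algebraMap _ _), ?_⟩
  ext r
  rw [RingHom.comp_apply, RingHom.comp_apply, HomogeneousLocalization.algebraMap_apply, val_toAway,
    IsLocalization.Away.lift_eq]
  apply hinj
  rw [hψ]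
  simp [e]

end Away

/-! ### Charts of the blowup, and existence and uniqueness of lifts -/

section UniversalProperty

variable {R : Type u} [CommRing R] {I : Ideal R}

/-- The open immersion of the affine chart of the blowup where `a t` does not vanish. -/
noncomputable def chart {a : R} (ha : a ∈ I) :
    Spec (CommRingCat.of (Away (grading I) (degreeOne ha))) ⟶ blowup I :=
  Proj.awayι (grading I) (degreeOne ha) (degreeOne_mem_grading ha) one_pos

instance {a : R} (ha : a ∈ I) : IsOpenImmersion (chart ha) :=
  inferInstanceAs (IsOpenImmersion (Proj.awayι _ _ _ _))

theorem chart_comp_blowupMap {a : R} (ha : a ∈ I) :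
    chart ha ≫ blowupMap I = Spec.map (CommRingCat.ofHom (toAway I (degreeOne ha))) := by
  refine (Proj.awayι_toSpecZero_assoc (grading I) (degreeOne ha) (degreeOne_mem_grading ha) one_pos
    (Spec.map (CommRingCat.ofHom (algebraMap R (grading I 0))))).trans ?_
  rw [← Spec.map_comp]
  rfl

theorem opensRange_chart {a : R} (ha : a ∈ I) :
    (chart ha).opensRange = Proj.basicOpen (grading I) (degreeOne ha) :=
  Proj.opensRange_awayι ..

theorem exists_mem_opensRange_chart (x : blowup I) :
    ∃ (a : R) (ha : a ∈ I), x ∈ (chart ha).opensRange := by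
  have h := Proj.iSup_basicOpen_eq_top (grading I) _ (irrelevant_le_span_degreeOne I)
  have hx : x ∈ ⨆ a : I, Proj.basicOpen (grading I) (degreeOne a.2) := by
    rw [h]
    trivial
  obtain ⟨a, ha⟩ := TopologicalSpace.Opens.mem_iSup.mp hx
  refine ⟨a, a.2, ?_⟩
  rw [opensRange_chart]
  exact ha

theorem chart_preimage_opensRange_chart {a b : R} (ha : a ∈ I) (hb : b ∈ I) (hb' : b ∈ I ^ 1) :
    chart ha ⁻¹ᵁ (chart hb).opensRange = PrimeSpectrum.basicOpen (fraction ha hb') := by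
  have : fraction ha hb' =
      Away.isLocalizationElem (degreeOne_mem_grading ha) (degreeOne_mem_grading hb) := by
    apply val_injective
    rw [Away.val_mk, fraction, Away.val_mk]
    congr 1
    exact (_root_.pow_one _).symm
  rw [this, opensRange_chart]
  exact Proj.awayι_preimage_basicOpen _ _ _ _ one_pos

/-- The source of `τ : Y ⟶ Spec R` is covered by affine opens on which the extension of `I` is
generated by a nonzerodivisor coming from an element of `I`. -/
def HasLocalGenerators (I : Ideal R) {Y : Scheme.{u}} (τ : Y ⟶ Spec (CommRingCat.of R)) : Prop :=
  ∀ y : Y, ∃ (C : CommRingCat.{u}) (j : Spec C ⟶ Y), IsOpenImmersion j ∧ y ∈ Set.range j ∧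
    ∃ φ : CommRingCat.of R ⟶ C, j ≫ τ = Spec.map φ ∧ ∃ a, GeneratesExtension I φ.hom a

theorem GeneratesExtension.of_isOpenImmersion {C D : CommRingCat.{u}} {φ : CommRingCat.of R ⟶ C}
    {a : R} (h : GeneratesExtension I φ.hom a) (j : Spec D ⟶ Spec C) [IsOpenImmersion j] :
    ∃ ψ : CommRingCat.of R ⟶ D, j ≫ Spec.map φ = Spec.map ψ ∧ GeneratesExtension I ψ.hom a := by
  obtain ⟨f, rfl⟩ := Spec.map_surjective j
  refine ⟨φ ≫ f, (Spec.map_comp _ _).symm, h.comp_of_flat ?_⟩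
  exact Flat.SpecMap_iff.mp inferInstance

theorem HasLocalGenerators.comp {Y Y' : Scheme.{u}} {τ : Y ⟶ Spec (CommRingCat.of R)}
    (h : HasLocalGenerators I τ) (f : Y' ⟶ Y) [IsOpenImmersion f] :
    HasLocalGenerators I (f ≫ τ) := by
  intro y
  obtain ⟨C, j, hj, hy, φ, hφ, a, ha⟩ := h (f y)
  have hy' : y ∈ Set.range (pullback.fst f j) := by
    rw [IsOpenImmersion.range_pullbackFst]
    exact hy
  obtain ⟨z, rfl⟩ := hy'
  obtain ⟨D, g, hg, w, rfl⟩ := Scheme.exists_Spec_apply_eq z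
  obtain ⟨ψ, hψ, hψa⟩ := ha.of_isOpenImmersion (g ≫ pullback.snd f j)
  refine ⟨D, g ≫ pullback.fst f j, inferInstance, ⟨w, by simp⟩, ψ, ?_, a, hψa⟩
  rw [← hψ, ← hφ, Category.assoc, Category.assoc, pullback.condition_assoc]

/-- Near a point sent into the chart of `b`, the fraction `a t / b t` pulls back to a unit, so the
point also lies in the chart of `a`. -/
theorem range_subset_range_chart {C : CommRingCat.{u}} {φ : CommRingCat.of R ⟶ C} {a : R}
    (h : GeneratesExtension I φ.hom a) {σ : Spec C ⟶ blowup I}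
    (hσ : σ ≫ blowupMap I = Spec.map φ) : Set.range σ ⊆ Set.range (chart h.mem) := by
  rintro _ ⟨y, rfl⟩
  obtain ⟨b, hb, hy⟩ := exists_mem_opensRange_chart (σ y)
  have hy' : y ∈ Set.range (pullback.fst σ (chart hb)) := by
    rw [IsOpenImmersion.range_pullbackFst]
    exact hy
  obtain ⟨z, rfl⟩ := hy'
  obtain ⟨D, g, hg, w, rfl⟩ := Scheme.exists_Spec_apply_eq z
  obtain ⟨ψ, hψ, hψa⟩ := h.of_isOpenImmersion (g ≫ pullback.fst σ (chart hb))
  obtain ⟨χ, hχ⟩ := Spec.map_surjective (g ≫ pullback.snd σ (chart hb))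
  have hfac : (g ≫ pullback.fst σ (chart hb)) ≫ σ = Spec.map χ ≫ chart hb := by
    rw [hχ, Category.assoc, Category.assoc, pullback.condition]
  have hχψ : CommRingCat.ofHom (toAway I (degreeOne hb)) ≫ χ = ψ := by
    apply Spec.map_injective
    rw [Spec.map_comp, ← chart_comp_blowupMap, ← Category.assoc, ← hfac, Category.assoc, hσ, hψ]
  have hχψ' : ∀ r, χ.hom (toAway I (degreeOne hb) r) = ψ.hom r := fun r => congr($hχψ r)
  have ha1 : a ∈ I ^ 1 := by simpa using h.mem
  -- With `b = a e` and `(a t / b t) * b = a` in `D`, cancelling `a` makes `e` inverse to the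
  -- fraction.
  have hunit : IsUnit (χ.hom (fraction hb ha1)) := by
    obtain ⟨e, he⟩ := hψa.dvd b hb
    have h1 := congr(χ.hom $(fraction_mul_toAway_pow hb ha1))
    rw [map_mul, hχψ', hχψ', pow_one, he] at h1
    refine IsUnit.of_mul_eq_one e ?_
    have h2 : (χ.hom (fraction hb ha1) * e - 1) * ψ.hom a = 0 := by linear_combination h1
    exact sub_eq_zero.mp (mem_nonZeroDivisors_iff_right.mp hψa.mem_nonZeroDivisors _ h2)
  have hmem : Spec.map χ w ∈ chart hb ⁻¹ᵁ (chart h.mem).opensRange := by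
    rw [chart_preimage_opensRange_chart hb h.mem ha1]
    exact fun hw => w.2.ne_top (Ideal.eq_top_of_isUnit_mem _ hw hunit)
  have h3 : chart hb (Spec.map χ w) = σ (pullback.fst σ (chart hb) (g w)) := by
    rw [← Scheme.Hom.comp_apply, ← hfac]
    simp
  rw [← h3]
  exact hmem

theorem hom_ext_of_generatesExtension {C : CommRingCat.{u}} {φ : CommRingCat.of R ⟶ C} {a : R}
    (h : GeneratesExtension I φ.hom a) {σ₁ σ₂ : Spec C ⟶ blowup I}
    (h₁ : σ₁ ≫ blowupMap I = Spec.map φ) (h₂ : σ₂ ≫ blowupMap I = Spec.map φ) : σ₁ = σ₂ := by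
  have key : ∀ σ : Spec C ⟶ blowup I, σ ≫ blowupMap I = Spec.map φ →
      ∃ χ : CommRingCat.of (Away (grading I) (degreeOne h.mem)) ⟶ C,
        σ = Spec.map χ ≫ chart h.mem ∧ χ.hom.comp (toAway I _) = φ.hom := by
    intro σ hσ
    obtain ⟨χ, hχ⟩ := Spec.map_surjective
      (IsOpenImmersion.lift (chart h.mem) σ (range_subset_range_chart h hσ))
    have hσ' : σ = Spec.map χ ≫ chart h.mem := by rw [hχ, IsOpenImmersion.lift_fac]
    refine ⟨χ, hσ', ?_⟩
    rw [hσ', Category.assoc, chart_comp_blowupMap, ← Spec.map_comp] at hσ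
    exact congr_arg CommRingCat.Hom.hom (Spec.map_injective hσ)
  obtain ⟨χ₁, rfl, e₁⟩ := key σ₁ h₁
  obtain ⟨χ₂, rfl, e₂⟩ := key σ₂ h₂
  have : χ₁.hom = χ₂.hom := by
    refine awayHom_ext h.mem (e₁.trans e₂.symm) ?_
    rw [← RingHom.comp_apply, e₁]
    exact h.mem_nonZeroDivisors
  rw [CommRingCat.hom_ext this]

theorem exists_lift_of_generatesExtension {C : CommRingCat.{u}} {φ : CommRingCat.of R ⟶ C} {a : R}
    (h : GeneratesExtension I φ.hom a) :
    ∃ σ : Spec C ⟶ blowup I, σ ≫ blowupMap I = Spec.map φ := by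
  obtain ⟨χ, hχ⟩ := exists_awayHom h
  refine ⟨Spec.map (CommRingCat.ofHom χ) ≫ chart h.mem, ?_⟩
  rw [Category.assoc, chart_comp_blowupMap, ← Spec.map_comp, ← CommRingCat.ofHom_comp, hχ]
  rfl

/-- The open cover of `Y` by affine opens with local generators. -/
noncomputable def HasLocalGenerators.openCover {Y : Scheme.{u}} {τ : Y ⟶ Spec (CommRingCat.of R)}
    (h : HasLocalGenerators I τ) : Y.OpenCover where
  I₀ := Y
  X y := Spec (h y).choose
  f y := (h y).choose_spec.choose
  mem₀ := by
    rw [Scheme.presieve₀_mem_precoverage_iff]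
    exact ⟨fun y => ⟨y, (h y).choose_spec.choose_spec.2.1⟩,
      fun y => (h y).choose_spec.choose_spec.1⟩

theorem HasLocalGenerators.exists_generatesExtension {Y : Scheme.{u}}
    {τ : Y ⟶ Spec (CommRingCat.of R)} (h : HasLocalGenerators I τ) (y : Y) :
    ∃ φ : CommRingCat.of R ⟶ (h y).choose, h.openCover.f y ≫ τ = Spec.map φ ∧
      ∃ a, GeneratesExtension I φ.hom a :=
  (h y).choose_spec.choose_spec.2.2

theorem HasLocalGenerators.hom_ext {Y : Scheme.{u}} {τ : Y ⟶ Spec (CommRingCat.of R)}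
    (h : HasLocalGenerators I τ) {σ₁ σ₂ : Y ⟶ blowup I} (h₁ : σ₁ ≫ blowupMap I = τ)
    (h₂ : σ₂ ≫ blowupMap I = τ) : σ₁ = σ₂ := by
  refine h.openCover.hom_ext _ _ fun y => ?_
  obtain ⟨φ, hφ, a, ha⟩ := h.exists_generatesExtension y
  exact hom_ext_of_generatesExtension ha ((Category.assoc _ _ _).trans ((congrArg _ h₁).trans hφ))
    ((Category.assoc _ _ _).trans ((congrArg _ h₂).trans hφ))

theorem HasLocalGenerators.existsUnique {Y : Scheme.{u}} {τ : Y ⟶ Spec (CommRingCat.of R)}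
    (h : HasLocalGenerators I τ) : ∃! σ : Y ⟶ blowup I, σ ≫ blowupMap I = τ := by
  have key : ∀ y, ∃ σ : h.openCover.X y ⟶ blowup I,
      σ ≫ blowupMap I = h.openCover.f y ≫ τ := by
    intro y
    obtain ⟨φ, hφ, a, ha⟩ := h.exists_generatesExtension y
    rw [hφ]
    exact exists_lift_of_generatesExtension ha
  choose s hs using key
  refine ⟨h.openCover.glueMorphisms s fun x y => ?_, ?_, fun σ hσ => h.hom_ext hσ ?_⟩
  -- Overlaps need not be affine, but they again have local generators, so uniqueness of lifts
  -- applies to them.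
  · have hxy := h.comp (pullback.fst (h.openCover.f x) (h.openCover.f y) ≫ h.openCover.f x)
    refine hxy.hom_ext ?_ ?_
    · simp [hs]
    · simp [hs, pullback.condition_assoc]
  all_goals
  · refine h.openCover.hom_ext _ _ fun y => ?_
    rw [Scheme.Cover.ι_glueMorphisms_assoc, hs]

/-! ### Cartier divisors and local generators -/

theorem hasLocalGenerators_of_isCartierDivisor {Y : Scheme.{u}} {τ : Y ⟶ Spec (CommRingCat.of R)}
    (h : IsCartierDivisor (pullback.fst τ (center I))) : HasLocalGenerators I τ := by
  intro y
  have key : ∃ U : Y.Opens, IsAffineOpen U ∧ y ∈ U ∧ ∃ f ∈ nonZeroDivisors Γ(Y, U),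
      I.map (toSections τ U).hom = Ideal.span {f} := by
    by_cases hy : y ∈ Set.range (pullback.fst τ (center I))
    · obtain ⟨z, rfl⟩ := hy
      obtain ⟨U, hU, hzU, f, hf, hker⟩ := h z
      exact ⟨U, hU, hzU, f, hf, by rw [← ker_pullback_fst_app τ I hU, hker]⟩
    -- The Cartier condition says nothing away from the divisor; there the inverse image is empty,
    -- its ideal is the unit ideal, and `1` generates it.
    · let V : Y.Opens := ⟨(Set.range (pullback.fst τ (center I)))ᶜ,
        (pullback.fst τ (center I)).isClosedEmbedding.isClosed_range.isOpen_compl⟩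
      obtain ⟨U, hU, hyU, hUV⟩ := exists_isAffineOpen_mem_and_subset (U := V) hy
      refine ⟨U, hU, hyU, 1, one_mem _, ?_⟩
      have hempty : pullback.fst τ (center I) ⁻¹ᵁ U = ⊥ := by
        ext z
        simpa using fun hz => hUV hz ⟨z, rfl⟩
      have : Subsingleton Γ(pullback τ (center I), pullback.fst τ (center I) ⁻¹ᵁ U) := by
        rw [hempty]
        infer_instance
      rw [← ker_pullback_fst_app τ I hU, Ideal.span_singleton_one, Ideal.eq_top_iff_one,
        RingHom.mem_ker]
      exact Subsingleton.elim _ _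
  obtain ⟨U, hU, hyU, f, hf, hI⟩ := key
  obtain ⟨p, rfl⟩ : y ∈ Set.range hU.fromSpec := by rwa [hU.range_fromSpec]
  obtain ⟨g, hg, a, ha⟩ := exists_generatesExtension_away hf hI p
  have hopen : IsOpenImmersion
      (Spec.map (CommRingCat.ofHom (algebraMap Γ(Y, U) (Localization.Away g)))) := inferInstance
  refine ⟨CommRingCat.of (Localization.Away g),
    Spec.map (CommRingCat.ofHom (algebraMap _ _)) ≫ hU.fromSpec, inferInstance, ?_,
    toSections τ U ≫ CommRingCat.ofHom (algebraMap _ _), ?_, a, ha⟩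
  · have : p ∈ Set.range (Spec.map (CommRingCat.ofHom
        (algebraMap Γ(Y, U) (Localization.Away g)))) := by
      have := PrimeSpectrum.localization_away_comap_range (Localization.Away g) g
      exact this.ge hg
    obtain ⟨q, rfl⟩ := this
    exact ⟨q, by simp⟩
  · rw [Category.assoc, fromSpec_comp, Spec.map_comp]

theorem isCartierDivisor_blowupMap (I : Ideal R) :
    IsCartierDivisor (pullback.fst (blowupMap I) (center I)) := by
  intro z
  obtain ⟨a, ha, hz⟩ := exists_mem_opensRange_chart (pullback.fst (blowupMap I) (center I) z)
  set U := (chart ha).opensRange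
  have hU : IsAffineOpen U := isAffineOpen_opensRange (chart ha)
  -- `e` compares the spectrum of `Γ(blowup I, U)` with that of the chart ring; being an open
  -- immersion is enough to carry the generator `a` over to the sections.
  let e := IsOpenImmersion.lift (chart ha) hU.fromSpec hU.range_fromSpec.le
  have he : e ≫ chart ha = hU.fromSpec := IsOpenImmersion.lift_fac _ _ _
  have : IsOpenImmersion (e ≫ chart ha) := by
    rw [he]
    infer_instance
  have : IsOpenImmersion e := IsOpenImmersion.of_comp e (chart ha)
  obtain ⟨ψ, hψ, hψa⟩ := GeneratesExtension.of_isOpenImmersion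
    (φ := CommRingCat.ofHom (toAway I (degreeOne ha))) (toAway_generatesExtension ha) e
  have hsec : toSections (blowupMap I) U = ψ :=
    toSections_eq _ hU (by rw [← he, Category.assoc, chart_comp_blowupMap, hψ])
  refine ⟨U, hU, hz, ψ.hom a, hψa.mem_nonZeroDivisors, ?_⟩
  rw [ker_pullback_fst_app _ I hU, hsec, hψa.map_eq_span]

end UniversalProperty

end ReesBlowup

theorem mainTheorem2 {R : Type u} [CommRing R] (I : Ideal R) :
    ReesBlowup.IsBlowup (ReesBlowup.center I) (ReesBlowup.blowupMap I) where
  isCartierDivisor := ReesBlowup.isCartierDivisor_blowupMap I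
  existsUnique _ h := (ReesBlowup.hasLocalGenerators_of_isCartierDivisor h).existsUnique
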